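/- An overpartition of a nonnegative integer $n$ is a partition of $n$ (a nonincreasing sequence of positive integers with sum $n$) in which the first occurrence of each distinct part may be overlined. Let $\overline{p}(n)$ denote the number of overpartitions of $n$ (so $\overline{p}(0)=1$ and $\overline{p}(3)=8$). Then for all integers $n,k\ge 0$, $$\overline{p}\big(4^k(40n+35)\big)\equiv 0 \pmod{40}.$$ -/

import Mathlib

/-- An overpartition of `n`: a partition of `n` together with the set of those distinct part
sizes whose first occurrence is overlined. -/
@[ext]
structure Overpartition (n : ℕ) where
  /-- the underlying partition, obtained by forgetting the overlines -/
  toPartition : n.Partition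
  /-- the part sizes whose first occurrence is overlined -/
  overlined : Finset ℕ
  /-- only sizes that occur as parts can be overlined -/
  overlined_subset : overlined ⊆ toPartition.parts.toFinset

/-- An overpartition is a partition with a subset of its set of distinct parts. -/
def Overpartition.equivSigma (n : ℕ) :
    Overpartition n ≃ Σ p : n.Partition, {S : Finset ℕ // S ∈ p.parts.toFinset.powerset} where
  toFun x := ⟨x.toPartition, x.overlined, Finset.mem_powerset.mpr x.overlined_subset⟩
  invFun y := ⟨y.1, y.2.1, Finset.mem_powerset.mp y.2.2⟩
  left_inv _ := rfl
  right_inv _ := rfl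

instance Overpartition.instFintype (n : ℕ) : Fintype (Overpartition n) :=
  Fintype.ofEquiv _ (Overpartition.equivSigma n).symm

/-- The number of overpartitions of `n`. -/
def overpartitionCount (n : ℕ) : ℕ := Fintype.card (Overpartition n)

/-!
The congruence modulo `40` splits into congruences modulo `8` and modulo `5`, and both follow from
Gauss's identity `P(X) φ(-X) = 1`, where `P` is the generating function of overpartitions and
`φ = ∑ X ^ (x ^ 2)`, summed over all integers `x` (`thetaSeries`). It is used in the form
`P(-X) φ(X) = 1` (`rescale_overpartitionSeries_mul_thetaSeries`), which only changes the signs of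
the coefficients of `P`. Since `P(X)` is the product of `(1 + X ^ i) / (1 - X ^ i)`, Gauss's
identity says that the product of `(1 - X ^ i) / (1 + X ^ i)` is `φ(-X)`; a finite version of this
with an explicit error term (`prod_one_add_pow_mul_alternating_sum_sq`) is proved by telescoping.

Modulo `8`: as `φ = 1 + 2 S`, we have `(φ - 1) ^ 3 = 0`, hence `P(-X) = 3 - 3 φ + φ ^ 2`, and
`8` divides the number of overpartitions of every `n` which is not a sum of two squares
(`eight_dvd_overpartitionCount`). Numbers `4 ^ k * (8 * m + 3)` are of this kind.

Modulo `5`: as `φ(X) ^ 5 = φ(X ^ 5)`, we have `P(-X) φ(X ^ 5) = φ(X) ^ 4`. The part of `φ ^ 4` with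
exponents divisible by `5` turns out to be `φ(X ^ 5) ^ 4`
(`residuePart_five_zero_thetaSeries_pow_four`), so the corresponding part of `P(-X)` is
`φ(X ^ 5) ^ 3`, and `5` divides the number of overpartitions of `5 * m` whenever `m` is not a sum of
three squares (`five_dvd_overpartitionCount_five_mul`). Numbers `4 ^ k * (8 * m + 7)` are of this
kind. The claim on `φ ^ 4` comes from the splitting `φ = a + b + c` according to the exponent modulo
`5`, which is `0`, `1` or `4`: the coefficients of `φ ^ 2` count lattice points on circles, and
factoring `5 = (2 + i) (2 - i)` in the Gaussian integers (`card_circlePoints_five_mul`) determines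
`a ^ 2 + 2 b c`, hence the product `b c`, which is all of `b` and `c` that enters the part in
question.
-/

open Finset PowerSeries

/-! ### A finite form of Gauss's identity -/

/-- A finite form, free of denominators, of Gauss's identity
`∏ (1 - q ^ i) / (1 + q ^ i) = 1 + 2 * ∑ (-1) ^ s * q ^ (s ^ 2)`. Every term of the sum on the
right is divisible by `q ^ (n + 1)`, so this sum is an error term. -/
theorem prod_one_add_pow_mul_alternating_sum_sq {R : Type*} [CommRing R] (q : R) (n : ℕ) :
    (∏ i ∈ Ico 1 (n + 1), (1 + q ^ i)) * (1 + 2 * ∑ s ∈ Ico 1 (n + 1), (-1) ^ s * q ^ s ^ 2) =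
      ∏ i ∈ Ico 1 (n + 1), (1 - q ^ i) +
        ∑ s ∈ Ico 1 (n + 1), 2 * (-1) ^ s * q ^ (s * (n + 1)) *
          (∏ i ∈ Ico (s + 1) (n + 1), (1 - q ^ i)) * ∏ i ∈ Ico 1 s, (1 + q ^ i) := by
  induction n with
  | zero => simp
  | succ m ih =>
    set n := m + 1 with hn
    -- from `n - 1` to `n`, each term of the error is multiplied by `1 + q ^ n`, like the left side,
    -- up to a difference of consecutive `B s`
    let B : ℕ → R := fun s ↦ 2 * (-1) ^ s * q ^ (s * n) * (∏ i ∈ Ico s n, (1 - q ^ i)) *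
      ∏ i ∈ Ico 1 s, (1 + q ^ i)
    have h1 : 1 ≤ n := by omega
    have key : ∀ s ∈ Ico 1 n, 2 * (-1) ^ s * q ^ (s * (n + 1)) *
          (∏ i ∈ Ico (s + 1) (n + 1), (1 - q ^ i)) * ∏ i ∈ Ico 1 s, (1 + q ^ i) =
        (1 + q ^ n) * (2 * (-1) ^ s * q ^ (s * n) *
          (∏ i ∈ Ico (s + 1) n, (1 - q ^ i)) * ∏ i ∈ Ico 1 s, (1 + q ^ i)) +
        (B (s + 1) - B s) := by
      intro s hs
      obtain ⟨h1s, hsn⟩ := mem_Ico.mp hs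
      simp only [B]
      rw [prod_Ico_succ_top (show s + 1 ≤ n by omega), prod_eq_prod_Ico_succ_bot hsn,
        prod_Ico_succ_top h1s]
      ring
    have htel : ∑ s ∈ Ico 1 n, (B (s + 1) - B s) = B n - B 1 := by
      rw [sum_Ico_eq_sum_range]
      have := Finset.sum_range_sub (fun k ↦ B (1 + k)) (n - 1)
      simp only [← add_assoc, add_zero] at this ⊢
      rw [this, show 1 + (n - 1) = n by omega]
    rw [prod_Ico_succ_top h1, prod_Ico_succ_top h1, sum_Ico_succ_top h1, sum_Ico_succ_top h1,
      sum_congr rfl key, sum_add_distrib, htel, ← mul_sum]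
    have hBn : B n = 2 * (-1) ^ n * q ^ (n * n) * ∏ i ∈ Ico 1 n, (1 + q ^ i) := by simp [B]
    have hB1 : B 1 = - (2 * q ^ n * ∏ i ∈ Ico 1 n, (1 - q ^ i)) := by simp [B]
    rw [hBn, hB1]
    simp only [Ico_self, prod_empty]
    linear_combination (1 + q ^ n) * ih

/-! ### The generating function of overpartitions -/

theorem overpartitionCount_eq_sum (n : ℕ) :
    overpartitionCount n = ∑ p : n.Partition, p.parts.toFinsupp.prod fun _ _ ↦ 2 := by
  rw [overpartitionCount, Fintype.card_congr (Overpartition.equivSigma n), Fintype.card_sigma]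
  refine sum_congr rfl fun p _ ↦ ?_
  rw [Fintype.card_coe, card_powerset]
  simp [Finsupp.prod]

/-- The generating function of the numbers of overpartitions. -/
noncomputable def overpartitionSeries : ℤ⟦X⟧ := PowerSeries.mk fun n ↦ (overpartitionCount n : ℤ)

/-- The theta series `∑ X ^ (x ^ 2)`, summed over all integers `x`, given by its coefficients:
`0` has one square root, and every positive square has two. -/
noncomputable def thetaSeries (R : Type*) [CommRing R] : R⟦X⟧ :=
  PowerSeries.mk fun n ↦ if n = 0 then 1 else if IsSquare n then 2 else 0

section
open scoped PowerSeries.WithPiTopology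
open Filter Topology

theorem hasProd_overpartitionSeries :
    HasProd (fun i ↦ (1 : ℤ⟦X⟧) + ∑' j, (2 : ℤ) • X ^ ((i + 1) * (j + 1)))
      overpartitionSeries := by
  have h : overpartitionSeries = Nat.Partition.genFun fun _ _ ↦ (2 : ℤ) := by
    ext n
    simp [overpartitionSeries, overpartitionCount_eq_sum, Finsupp.prod]
  rw [h]
  exact Nat.Partition.hasProd_genFun fun _ _ ↦ (2 : ℤ)

/-- The parts of size `i + 1` contribute the factor `(1 + X ^ (i + 1)) / (1 - X ^ (i + 1))` to the
generating function of overpartitions. -/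
theorem one_sub_mul_overpartition_factor (i : ℕ) :
    (1 - X ^ (i + 1)) * ((1 : ℤ⟦X⟧) + ∑' j, (2 : ℤ) • X ^ ((i + 1) * (j + 1))) =
      1 + X ^ (i + 1) := by
  have hc : constantCoeff ((X : ℤ⟦X⟧) ^ (i + 1)) = 0 := by simp
  have h := WithPiTopology.one_sub_mul_tsum_pow_of_constantCoeff_eq_zero hc
  have hs := WithPiTopology.summable_pow_of_constantCoeff_eq_zero hc
  have e : ∑' j, (2 : ℤ) • (X : ℤ⟦X⟧) ^ ((i + 1) * (j + 1)) =
      2 * X ^ (i + 1) * ∑' j, ((X : ℤ⟦X⟧) ^ (i + 1)) ^ j := by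
    rw [← hs.tsum_mul_left]
    refine tsum_congr fun j ↦ ?_
    rw [zsmul_eq_mul]
    push_cast
    ring
  rw [e]
  linear_combination 2 * X ^ (i + 1) * h

theorem coeff_alternating_sum_sq_eq_coeff_rescale_thetaSeries (m n : ℕ) (h : m ≤ n) :
    coeff m (1 + 2 * ∑ s ∈ Ico 1 (n + 1), (-1) ^ s * (X : ℤ⟦X⟧) ^ s ^ 2) =
      coeff m (rescale (-1) (thetaSeries ℤ)) := by
  have e : (2 : ℤ⟦X⟧) = C (2 : ℤ) := rfl
  have e' (s : ℕ) : (-1 : ℤ⟦X⟧) ^ s = C ((-1 : ℤ) ^ s) := by simp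
  simp only [e, e', map_add, map_sum, coeff_C_mul, coeff_X_pow, coeff_one, coeff_rescale,
    thetaSeries, coeff_mk]
  rcases Nat.eq_zero_or_pos m with rfl | hm
  · rw [sum_eq_zero]
    · simp
    · intro s hs
      rw [if_neg (by have := (mem_Ico.mp hs).1; positivity), mul_zero]
  rw [if_neg hm.ne', if_neg hm.ne']
  by_cases hsq : IsSquare m
  · obtain ⟨t, rfl⟩ := hsq
    have ht : 0 < t := Nat.pos_of_mul_pos_right hm
    rw [if_pos ⟨t, rfl⟩, sum_eq_single t]
    · rw [if_pos (by ring), ← pow_two]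
      rcases Nat.even_or_odd t with h | h
      · simp [h.neg_one_pow, (h.pow_of_ne_zero two_ne_zero).neg_one_pow]
      · simp [h.neg_one_pow, (h.pow).neg_one_pow]
    · intro s _ hs
      rw [if_neg, mul_zero]
      rw [← pow_two]
      exact fun h ↦ hs (Nat.pow_left_injective two_ne_zero h).symm
    · intro h'
      exact absurd (mem_Ico.mpr ⟨ht, by nlinarith⟩) h'
  · rw [if_neg hsq, sum_eq_zero]
    · simp
    · intro s _
      rw [if_neg, mul_zero]
      rintro rfl
      exact hsq ⟨s, by ring⟩

/-- **Gauss's identity**: the reciprocal of the generating function of overpartitions is `φ(-X)`,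
where `φ` is the theta series. -/
theorem overpartitionSeries_mul_rescale_thetaSeries :
    overpartitionSeries * rescale (-1) (thetaSeries ℤ) = 1 := by
  set F : ℕ → ℤ⟦X⟧ := fun i ↦ 1 + ∑' j, (2 : ℤ) • X ^ ((i + 1) * (j + 1)) with hF
  set S : ℕ → ℤ⟦X⟧ := fun n ↦ 1 + 2 * ∑ s ∈ Ico 1 (n + 1), (-1) ^ s * X ^ s ^ 2 with hS
  have hP : Tendsto (fun n ↦ ∏ i ∈ range n, F i) atTop (𝓝 overpartitionSeries) :=
    hasProd_overpartitionSeries.tendsto_prod_nat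
  have hT : Tendsto S atTop (𝓝 (rescale (-1) (thetaSeries ℤ))) := by
    rw [WithPiTopology.tendsto_iff_coeff_tendsto]
    exact fun m ↦ tendsto_atTop_of_eventually_const fun n (hn : n ≥ m) ↦
      coeff_alternating_sum_sq_eq_coeff_rescale_thetaSeries m n hn
  have hdvd (n : ℕ) : (X : ℤ⟦X⟧) ^ (n + 1) ∣ (∏ i ∈ range n, F i) * S n - 1 := by
    have hN : (∏ i ∈ Ico 1 (n + 1), (1 - (X : ℤ⟦X⟧) ^ i)) * ∏ i ∈ range n, F i =
        ∏ i ∈ Ico 1 (n + 1), (1 + (X : ℤ⟦X⟧) ^ i) := by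
      rw [prod_Ico_eq_prod_range, prod_Ico_eq_prod_range, Nat.add_sub_cancel, ← prod_mul_distrib]
      refine prod_congr rfl fun i _ ↦ ?_
      rw [add_comm 1 i]
      exact one_sub_mul_overpartition_factor i
    have hD : ¬ (X : ℤ⟦X⟧) ∣ ∏ i ∈ Ico 1 (n + 1), (1 + (X : ℤ⟦X⟧) ^ i) := by
      rw [X_dvd_iff, map_prod, prod_eq_one]
      · exact one_ne_zero
      · intro i hi
        have : i ≠ 0 := by have := (mem_Ico.mp hi).1; omega
        simp [this]
    -- the factor `∏ (1 + X ^ i)`, not divisible by `X`, clears the denominators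
    refine X_prime.pow_dvd_of_dvd_mul_left _ hD ?_
    have h := prod_one_add_pow_mul_alternating_sum_sq (X : ℤ⟦X⟧) n
    have e : (∏ i ∈ Ico 1 (n + 1), (1 + (X : ℤ⟦X⟧) ^ i)) * ((∏ i ∈ range n, F i) * S n - 1) =
        (∏ i ∈ range n, F i) * ∑ s ∈ Ico 1 (n + 1), 2 * (-1) ^ s * X ^ (s * (n + 1)) *
          (∏ i ∈ Ico (s + 1) (n + 1), (1 - X ^ i)) * ∏ i ∈ Ico 1 s, (1 + X ^ i) := by
      simp only [hS]
      linear_combination (∏ i ∈ range n, F i) * h + hN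
    rw [e]
    refine Dvd.dvd.mul_left (dvd_sum fun s hs ↦ ?_) _
    have hs1 := (mem_Ico.mp hs).1
    refine Dvd.dvd.mul_right (Dvd.dvd.mul_right (Dvd.dvd.mul_left ?_ _) _) _
    exact pow_dvd_pow _ (Nat.le_mul_of_pos_left _ hs1)
  have h1 : Tendsto (fun n ↦ (∏ i ∈ range n, F i) * S n) atTop (𝓝 1) := by
    rw [WithPiTopology.tendsto_iff_coeff_tendsto]
    refine fun m ↦ tendsto_atTop_of_eventually_const (i₀ := m) fun n hn ↦ ?_
    have := X_pow_dvd_iff.mp (hdvd n) m (by omega)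
    rwa [map_sub, sub_eq_zero] at this
  exact tendsto_nhds_unique (hP.mul hT) h1

end

/-- Gauss's identity after `X ↦ -X`, with coefficients in an arbitrary commutative ring. -/
theorem rescale_overpartitionSeries_mul_thetaSeries (R : Type*) [CommRing R] :
    PowerSeries.map (Int.castRingHom R) (rescale (-1) overpartitionSeries) * thetaSeries R = 1 := by
  have h := congrArg (fun f ↦ PowerSeries.map (Int.castRingHom R) (rescale (-1) f))
    overpartitionSeries_mul_rescale_thetaSeries
  simp only [map_mul, map_one, rescale_rescale] at h
  rw [← h]
  congr 1
  ext n
  simp only [thetaSeries, coeff_map, coeff_rescale, coeff_mk]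
  split_ifs <;> simp

/-! ### Coefficients of powers of the theta series and sums of squares -/

theorem isSquare_of_coeff_thetaSeries_ne_zero {R : Type*} [CommRing R] {n : ℕ}
    (h : coeff n (thetaSeries R) ≠ 0) : IsSquare n := by
  rw [thetaSeries, coeff_mk] at h
  by_contra hn
  have h0 : n ≠ 0 := by rintro rfl; exact hn ⟨0, rfl⟩
  simp [hn, h0] at h

theorem exists_of_coeff_mul_ne_zero {R : Type*} [CommRing R] {f g : R⟦X⟧} {n : ℕ}
    (h : coeff n (f * g) ≠ 0) : ∃ i j, i + j = n ∧ coeff i f ≠ 0 ∧ coeff j g ≠ 0 := by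
  rw [coeff_mul] at h
  obtain ⟨⟨i, j⟩, hij, hne⟩ := exists_ne_zero_of_sum_ne_zero h
  exact ⟨i, j, mem_antidiagonal.mp hij, left_ne_zero_of_mul hne, right_ne_zero_of_mul hne⟩

theorem exists_sq_add_sq_of_coeff_thetaSeries_sq_ne_zero {R : Type*} [CommRing R] {n : ℕ}
    (h : coeff n (thetaSeries R ^ 2) ≠ 0) : ∃ x y : ℕ, x ^ 2 + y ^ 2 = n := by
  rw [pow_two] at h
  obtain ⟨i, j, rfl, hi, hj⟩ := exists_of_coeff_mul_ne_zero h
  obtain ⟨x, rfl⟩ := isSquare_of_coeff_thetaSeries_ne_zero hi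
  obtain ⟨y, rfl⟩ := isSquare_of_coeff_thetaSeries_ne_zero hj
  exact ⟨x, y, by ring⟩

theorem exists_sum_three_sq_of_coeff_thetaSeries_cube_ne_zero {R : Type*} [CommRing R] {n : ℕ}
    (h : coeff n (thetaSeries R ^ 3) ≠ 0) : ∃ x y z : ℕ, x ^ 2 + y ^ 2 + z ^ 2 = n := by
  rw [pow_succ] at h
  obtain ⟨i, j, rfl, hi, hj⟩ := exists_of_coeff_mul_ne_zero h
  obtain ⟨x, y, rfl⟩ := exists_sq_add_sq_of_coeff_thetaSeries_sq_ne_zero hi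
  obtain ⟨z, rfl⟩ := isSquare_of_coeff_thetaSeries_ne_zero hj
  exact ⟨x, y, z, by ring⟩

theorem sq_mod_four_eq_zero_and_even_or_eq_one (t : ℕ) :
    t ^ 2 % 4 = 0 ∧ 2 ∣ t ∨ t ^ 2 % 4 = 1 := by
  rcases Nat.even_or_odd' t with ⟨c, rfl | rfl⟩
  · exact Or.inl ⟨by ring_nf; omega, Dvd.intro _ rfl⟩
  · exact Or.inr (by ring_nf; omega)

theorem sum_three_sq_ne_four_pow_mul (m k x y z : ℕ) :
    x ^ 2 + y ^ 2 + z ^ 2 ≠ 4 ^ k * (8 * m + 7) := by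
  have h8 (t : ℕ) : t ^ 2 % 8 = 0 ∨ t ^ 2 % 8 = 1 ∨ t ^ 2 % 8 = 4 := by
    have h := Nat.pow_mod t 2 8
    have : t % 8 < 8 := Nat.mod_lt _ (by norm_num)
    interval_cases t % 8 <;> omega
  induction k generalizing x y z with
  | zero =>
    have := h8 x; have := h8 y; have := h8 z
    omega
  | succ k ih =>
    intro h
    have hx := sq_mod_four_eq_zero_and_even_or_eq_one x
    have hy := sq_mod_four_eq_zero_and_even_or_eq_one y
    have hz := sq_mod_four_eq_zero_and_even_or_eq_one z
    rw [pow_succ 4 k] at h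
    have h0 : (x ^ 2 + y ^ 2 + z ^ 2) % 4 = 0 := by rw [h, mul_assoc, mul_left_comm]; simp
    obtain ⟨⟨a, rfl⟩, ⟨b, rfl⟩, ⟨c, rfl⟩⟩ : 2 ∣ x ∧ 2 ∣ y ∧ 2 ∣ z := by omega
    exact ih a b c (by linarith)

theorem sum_two_sq_ne_four_pow_mul (m k x y : ℕ) : x ^ 2 + y ^ 2 ≠ 4 ^ k * (8 * m + 3) := by
  induction k generalizing x y with
  | zero =>
    have := sq_mod_four_eq_zero_and_even_or_eq_one x
    have := sq_mod_four_eq_zero_and_even_or_eq_one y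
    omega
  | succ k ih =>
    intro h
    have hx := sq_mod_four_eq_zero_and_even_or_eq_one x
    have hy := sq_mod_four_eq_zero_and_even_or_eq_one y
    rw [pow_succ 4 k] at h
    have h0 : (x ^ 2 + y ^ 2) % 4 = 0 := by rw [h, mul_assoc, mul_left_comm]; simp
    obtain ⟨⟨a, rfl⟩, ⟨b, rfl⟩⟩ : 2 ∣ x ∧ 2 ∣ y := by omega
    exact ih a b (by linarith)

/-! ### Divisibility by eight -/

theorem coeff_map_rescale_overpartitionSeries_eq_zero_iff {d n : ℕ} :
    coeff n (PowerSeries.map (Int.castRingHom (ZMod d)) (rescale (-1) overpartitionSeries)) = 0 ↔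
      d ∣ overpartitionCount n := by
  rw [coeff_map, coeff_rescale, overpartitionSeries, coeff_mk, eq_intCast,
    ZMod.intCast_zmod_eq_zero_iff_dvd]
  rw [(isUnit_neg_one.pow n).dvd_mul_left, Int.natCast_dvd_natCast]

theorem eight_dvd_overpartitionCount {n : ℕ} (h : ∀ x y : ℕ, x ^ 2 + y ^ 2 ≠ n) :
    8 ∣ overpartitionCount n := by
  rw [← coeff_map_rescale_overpartitionSeries_eq_zero_iff]
  have hP := rescale_overpartitionSeries_mul_thetaSeries (ZMod 8)
  set P := PowerSeries.map (Int.castRingHom (ZMod 8)) (rescale (-1) overpartitionSeries)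
  set T := thetaSeries (ZMod 8) with hT
  obtain ⟨S, hS⟩ : ∃ S : (ZMod 8)⟦X⟧, T = 1 + 2 * S := by
    refine ⟨PowerSeries.mk fun n ↦ if n = 0 then 0 else if IsSquare n then 1 else 0, ?_⟩
    ext m
    rw [show (2 : (ZMod 8)⟦X⟧) = C (2 : ZMod 8) from rfl, map_add, coeff_C_mul, coeff_one, hT,
      thetaSeries, coeff_mk, coeff_mk]
    split_ifs <;> simp
  have h8 : (8 : (ZMod 8)⟦X⟧) = 0 := by
    rw [show (8 : (ZMod 8)⟦X⟧) = C (8 : ZMod 8) from rfl, show (8 : ZMod 8) = 0 from rfl, map_zero]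
  have hPT : P = C (3 : ZMod 8) - C (3 : ZMod 8) * T + T ^ 2 := by
    rw [show C (3 : ZMod 8) = (3 : (ZMod 8)⟦X⟧) from rfl]
    have : (T - 1) ^ 3 = 0 := by rw [hS]; linear_combination S ^ 3 * h8
    linear_combination (3 - 3 * T + T ^ 2) * hP - P * this
  have h0 : n ≠ 0 := by rintro rfl; exact h 0 0 rfl
  have h1 : coeff n T = 0 := by
    by_contra hne
    obtain ⟨x, rfl⟩ := isSquare_of_coeff_thetaSeries_ne_zero hne
    exact h x 0 (by ring)
  have h2 : coeff n (T ^ 2) = 0 := by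
    by_contra hne
    obtain ⟨x, y, hxy⟩ := exists_sq_add_sq_of_coeff_thetaSeries_sq_ne_zero hne
    exact h x y hxy
  rw [hPT, map_add, map_sub, coeff_C_mul, coeff_C, if_neg h0, h1, h2]
  ring

/-! ### Lattice points on circles -/

/-- The lattice points on the circle `x ^ 2 + y ^ 2 = n`. The box only makes the set visibly finite:
it contains all solutions. -/
noncomputable def circlePoints (n : ℕ) : Finset (ℤ × ℤ) :=
  (Icc (-n : ℤ) n ×ˢ Icc (-n : ℤ) n).filter fun p ↦ p.1 ^ 2 + p.2 ^ 2 = n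

theorem mem_circlePoints {n : ℕ} {p : ℤ × ℤ} :
    p ∈ circlePoints n ↔ p.1 ^ 2 + p.2 ^ 2 = n := by
  simp only [circlePoints, mem_filter, mem_product, mem_Icc, and_iff_right_iff_imp]
  intro h
  have h1 := Int.le_self_sq p.1
  have h2 := Int.le_self_sq p.2
  have h3 := Int.le_self_sq (-p.1)
  have h4 := Int.le_self_sq (-p.2)
  refine ⟨⟨?_, ?_⟩, ?_, ?_⟩ <;> nlinarith [sq_nonneg p.1, sq_nonneg p.2]

/-- The integers with square `n`; the bounds only make the set visibly finite. -/
noncomputable def intSqrts (n : ℕ) : Finset ℤ := (Icc (-n : ℤ) n).filter fun x ↦ x ^ 2 = n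

theorem mem_intSqrts {n : ℕ} {x : ℤ} : x ∈ intSqrts n ↔ x ^ 2 = n := by
  simp only [intSqrts, mem_filter, mem_Icc, and_iff_right_iff_imp]
  intro h
  have h1 := Int.le_self_sq x
  have h3 := Int.le_self_sq (-x)
  constructor <;> nlinarith

theorem coeff_thetaSeries_eq_card (R : Type*) [CommRing R] (n : ℕ) :
    coeff n (thetaSeries R) = ((intSqrts n).card : R) := by
  rw [thetaSeries, coeff_mk]
  by_cases hn : IsSquare n
  · obtain ⟨t, rfl⟩ := hn
    have h : intSqrts (t * t) = {(t : ℤ), -(t : ℤ)} := by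
      ext x
      rw [mem_intSqrts, mem_insert, mem_singleton, ← sq_eq_sq_iff_eq_or_eq_neg]
      push_cast
      rw [pow_two (t : ℤ)]
    rw [h]
    rcases Nat.eq_zero_or_pos t with rfl | ht
    · simp
    · rw [card_pair (by omega), if_neg (by positivity), if_pos ⟨t, rfl⟩]
      rfl
  · have h : intSqrts n = ∅ := by
      rw [eq_empty_iff_forall_notMem]
      intro x hx
      rw [mem_intSqrts] at hx
      refine hn ⟨x.natAbs, ?_⟩
      zify
      rw [← hx, ← pow_two, sq_abs]
    have h0 : n ≠ 0 := by rintro rfl; exact hn ⟨0, rfl⟩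
    simp [h, hn, h0]

theorem coeff_thetaSeries_sq_eq_card (R : Type*) [CommRing R] (n : ℕ) :
    coeff n (thetaSeries R ^ 2) = ((circlePoints n).card : R) := by
  have hmaps : ∀ p ∈ circlePoints n,
      (p.1.natAbs ^ 2, p.2.natAbs ^ 2) ∈ antidiagonal n := by
    intro p hp
    rw [mem_circlePoints] at hp
    rw [HasAntidiagonal.mem_antidiagonal]
    zify
    simpa using hp
  rw [card_eq_sum_card_fiberwise hmaps, pow_two, coeff_mul, Nat.cast_sum]
  refine sum_congr rfl fun ij hij ↦ ?_
  rw [coeff_thetaSeries_eq_card, coeff_thetaSeries_eq_card, ← Nat.cast_mul, ← card_product]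
  congr 2
  ext p
  rw [HasAntidiagonal.mem_antidiagonal] at hij
  simp only [mem_product, mem_intSqrts, mem_filter, mem_circlePoints, Prod.ext_iff]
  zify
  rw [← hij]
  push_cast [sq_abs]
  constructor
  · rintro ⟨h1, h2⟩
    exact ⟨by rw [h1, h2], h1, h2⟩
  · exact fun h ↦ h.2

/-- In the Gaussian integers, an element of norm `5 * n` is divisible by `2 + i` or by `2 - i`, and
it is divisible by both exactly when it is divisible by `5`; so the claim is
inclusion-exclusion. -/
theorem card_circlePoints_five_mul (n : ℕ) :
    (circlePoints (5 * n)).card + (if 5 ∣ n then (circlePoints (n / 5)).card else 0) =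
      2 * (circlePoints n).card := by
  -- multiplication by `2 + s * i` is a bijection from norm `n` onto its multiples of norm `5 * n`
  have hsplit (s : ℤ) (hs : s ^ 2 = 1) :
      ((circlePoints (5 * n)).filter fun p ↦ 5 ∣ p.1 - 2 * s * p.2).card =
        (circlePoints n).card := by
    symm
    refine card_bij (fun p _ ↦ (2 * p.1 - s * p.2, s * p.1 + 2 * p.2)) ?_ ?_ ?_
    · intro p hp
      rw [mem_circlePoints] at hp
      rw [mem_filter, mem_circlePoints]
      push_cast
      refine ⟨by linear_combination 5 * hp + (p.1 ^ 2 + p.2 ^ 2) * hs, -(s * p.2), ?_⟩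
      linear_combination (-2 * p.1) * hs
    · intro p _ p' _ h
      rw [Prod.mk.injEq] at h
      obtain ⟨h1, h2⟩ := h
      refine Prod.ext ?_ ?_
      · have : 5 * p.1 = 5 * p'.1 := by
          linear_combination 2 * h1 + s * h2 - (p.1 - p'.1) * hs
        omega
      · have : 5 * p.2 = 5 * p'.2 := by
          linear_combination 2 * h2 - s * h1 - (p.2 - p'.2) * hs
        omega
    · rintro ⟨x, y⟩ hp
      rw [mem_filter, mem_circlePoints] at hp
      obtain ⟨h1, c, hc⟩ := hp
      dsimp only at h1 hc
      push_cast at h1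
      refine ⟨(2 * c + s * y, -(s * c)), ?_, ?_⟩
      · rw [mem_circlePoints]
        have hx : x = 2 * s * y + 5 * c := by linarith
        subst hx
        have : 5 * ((2 * c + s * y) ^ 2 + (-(s * c)) ^ 2) = 5 * (n : ℤ) := by
          linear_combination h1 + (5 * c ^ 2 + y ^ 2) * hs
        dsimp only
        linarith
      · ext
        · dsimp only
          linear_combination (-1) * hc + (c) * hs
        · dsimp only
          linear_combination (y) * hs
  have hunion : ((circlePoints (5 * n)).filter fun p ↦ 5 ∣ p.1 - 2 * 1 * p.2) ∪
      ((circlePoints (5 * n)).filter fun p ↦ 5 ∣ p.1 - 2 * (-1) * p.2) = circlePoints (5 * n) := by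
    rw [← filter_or, filter_eq_self]
    intro p hp
    rw [mem_circlePoints] at hp
    push_cast at hp
    have h5 : Prime (5 : ℤ) := by norm_num
    refine h5.dvd_or_dvd ⟨n - p.2 ^ 2, ?_⟩
    linear_combination hp
  have hinter : (((circlePoints (5 * n)).filter fun p ↦ 5 ∣ p.1 - 2 * 1 * p.2) ∩
      ((circlePoints (5 * n)).filter fun p ↦ 5 ∣ p.1 - 2 * (-1) * p.2)).card =
        if 5 ∣ n then (circlePoints (n / 5)).card else 0 := by
    rw [← filter_and]
    split_ifs with hn
    · obtain ⟨m, rfl⟩ := hn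
      rw [Nat.mul_div_cancel_left _ (by norm_num)]
      symm
      refine card_bij (fun p _ ↦ (5 * p.1, 5 * p.2)) ?_ ?_ ?_
      · intro p hp
        rw [mem_circlePoints] at hp
        rw [mem_filter, mem_circlePoints]
        push_cast
        exact ⟨by linear_combination 25 * hp, by omega, by omega⟩
      · intro p _ p' _ h
        rw [Prod.mk.injEq] at h
        exact Prod.ext (by omega) (by omega)
      · rintro ⟨x, y⟩ hp
        rw [mem_filter, mem_circlePoints] at hp
        obtain ⟨h1, h2, h3⟩ := hp
        dsimp only at h1 h2 h3
        push_cast at h1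
        obtain ⟨⟨u, rfl⟩, ⟨v, rfl⟩⟩ : 5 ∣ x ∧ 5 ∣ y := by omega
        refine ⟨(u, v), ?_, rfl⟩
        rw [mem_circlePoints]
        dsimp only
        linarith
    · rw [card_eq_zero, filter_eq_empty_iff]
      rintro ⟨x, y⟩ hp ⟨h2, h3⟩
      rw [mem_circlePoints] at hp
      dsimp only at hp h2 h3
      push_cast at hp
      obtain ⟨⟨u, rfl⟩, ⟨v, rfl⟩⟩ : 5 ∣ x ∧ 5 ∣ y := by omega
      refine hn (Int.natCast_dvd_natCast.mp ⟨u ^ 2 + v ^ 2, ?_⟩)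
      push_cast
      linarith
  have h := card_union_add_card_inter
    ((circlePoints (5 * n)).filter fun p ↦ 5 ∣ p.1 - 2 * 1 * p.2)
    ((circlePoints (5 * n)).filter fun p ↦ 5 ∣ p.1 - 2 * (-1) * p.2)
  rw [hunion, hinter, hsplit 1 (by norm_num), hsplit (-1) (by norm_num)] at h
  omega

/-! ### Splitting power series by residues of exponents -/

section
variable {R : Type*} [CommRing R]

/-- All exponents occurring in the power series `f` are congruent to `j` modulo `d`. -/
def SupportedMod (d : ℕ) (j : ZMod d) (f : R⟦X⟧) : Prop :=
  ∀ n, coeff n f ≠ 0 → (n : ZMod d) = j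

theorem SupportedMod.mul {d : ℕ} {i j : ZMod d} {f g : R⟦X⟧} (hf : SupportedMod d i f)
    (hg : SupportedMod d j g) : SupportedMod d (i + j) (f * g) := by
  intro n hn
  obtain ⟨k, l, rfl, hk, hl⟩ := exists_of_coeff_mul_ne_zero hn
  rw [Nat.cast_add, hf k hk, hg l hl]

theorem supportedMod_one (d : ℕ) : SupportedMod d 0 (1 : R⟦X⟧) := by
  intro n hn
  rw [coeff_one] at hn
  have : n = 0 := by by_contra h; simp [h] at hn
  simp [this]

theorem SupportedMod.pow {d : ℕ} {i : ZMod d} {f : R⟦X⟧} (hf : SupportedMod d i f) (k : ℕ) :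
    SupportedMod d (k * i) (f ^ k) := by
  induction k with
  | zero => simpa using supportedMod_one d
  | succ k ih =>
    rw [pow_succ, Nat.cast_succ, add_one_mul]
    exact ih.mul hf

theorem supportedMod_expand {d : ℕ} (hd : d ≠ 0) (f : R⟦X⟧) :
    SupportedMod d 0 (expand d hd f) := by
  intro n hn
  rw [coeff_expand] at hn
  rw [ZMod.natCast_eq_zero_iff]
  by_contra h
  simp [h] at hn

/-- The part of a power series consisting of the terms with exponent congruent to `j` modulo `d`. -/
noncomputable def residuePart (d : ℕ) (j : ZMod d) : R⟦X⟧ →ₗ[R] R⟦X⟧ where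
  toFun f := PowerSeries.mk fun n ↦ if (n : ZMod d) = j then coeff n f else 0
  map_add' f g := by ext n; simp only [coeff_mk, map_add]; split_ifs <;> simp
  map_smul' r f := by ext n; simp

theorem coeff_residuePart (d : ℕ) (j : ZMod d) (f : R⟦X⟧) (n : ℕ) :
    coeff n (residuePart d j f) = if (n : ZMod d) = j then coeff n f else 0 :=
  coeff_mk n fun m ↦ if (m : ZMod d) = j then coeff m f else 0

theorem supportedMod_residuePart (d : ℕ) (j : ZMod d) (f : R⟦X⟧) :
    SupportedMod d j (residuePart d j f) := by
  intro n hn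
  rw [coeff_residuePart] at hn
  by_contra h
  simp [h] at hn

theorem SupportedMod.residuePart_eq {d : ℕ} {j : ZMod d} {f : R⟦X⟧} (hf : SupportedMod d j f) :
    residuePart d j f = f := by
  ext n
  rw [coeff_residuePart]
  split_ifs with h
  · rfl
  · by_contra hne
    exact h (hf n (Ne.symm hne))

theorem SupportedMod.residuePart_eq_zero {d : ℕ} {i j : ZMod d} {f : R⟦X⟧}
    (hf : SupportedMod d i f) (hij : i ≠ j) : residuePart d j f = 0 := by
  ext n
  rw [coeff_residuePart, map_zero, ite_eq_right_iff]
  rintro rfl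
  by_contra hne
  exact hij (hf n hne).symm

theorem residuePart_mul_of_supportedMod_zero {d : ℕ} (j : ZMod d) (f : R⟦X⟧) {g : R⟦X⟧}
    (hg : SupportedMod d 0 g) : residuePart d j (f * g) = residuePart d j f * g := by
  ext n
  have key : ∀ p ∈ antidiagonal n, coeff p.1 (residuePart d j f) * coeff p.2 g =
      if (n : ZMod d) = j then coeff p.1 f * coeff p.2 g else 0 := by
    intro p hp
    rw [HasAntidiagonal.mem_antidiagonal] at hp
    by_cases h : coeff p.2 g = 0
    · simp [h]
    · rw [coeff_residuePart, ← hp, Nat.cast_add, hg _ h, add_zero, ite_mul, zero_mul]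
  rw [coeff_residuePart, coeff_mul, coeff_mul, sum_congr rfl key]
  split_ifs <;> simp

/-! ### The theta series modulo five -/

theorem coeff_thetaSeries_mul_self (d : ℕ) (hd : d ≠ 0) (n : ℕ) :
    coeff (d * (d * n)) (thetaSeries R) = coeff n (thetaSeries R) := by
  have h : IsSquare (d * (d * n)) ↔ IsSquare n := by
    rw [← mul_assoc, ← pow_two]
    constructor
    · rintro ⟨t, ht⟩
      have hdt : d ^ 2 ∣ t ^ 2 := ⟨n, by rw [ht, pow_two]⟩
      obtain ⟨u, rfl⟩ := (Nat.pow_dvd_pow_iff two_ne_zero).mp hdt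
      exact ⟨u, Nat.eq_of_mul_eq_mul_left (by positivity) (ht.trans (by ring))⟩
    · exact fun h ↦ (IsSquare.sq d).mul h
  simp only [thetaSeries, coeff_mk, h, mul_eq_zero, hd, false_or]

theorem residuePart_zero_thetaSeries {p : ℕ} (hp : p.Prime) :
    residuePart p 0 (thetaSeries R) =
      expand p hp.ne_zero (expand p hp.ne_zero (thetaSeries R)) := by
  ext n
  rw [coeff_residuePart, coeff_expand]
  simp only [ZMod.natCast_eq_zero_iff]
  split_ifs with h
  · obtain ⟨m, rfl⟩ := h
    rw [Nat.mul_div_cancel_left _ hp.pos, coeff_expand]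
    split_ifs with h
    · obtain ⟨l, rfl⟩ := h
      rw [Nat.mul_div_cancel_left _ hp.pos, coeff_thetaSeries_mul_self p hp.ne_zero]
    · by_contra hne
      obtain ⟨t, ht⟩ := isSquare_of_coeff_thetaSeries_ne_zero hne
      obtain ⟨u, rfl⟩ : p ∣ t := by
        rcases hp.dvd_mul.mp (Dvd.intro _ ht) with h | h <;> exact h
      exact h ⟨u * u, Nat.eq_of_mul_eq_mul_left hp.pos (ht.trans (by ring))⟩
  · rfl

/-- The count of lattice points on circles of squared radius `5 * n`, in terms of generating
functions: the part of `φ ^ 2` with exponents divisible by `5` is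
`2 φ(X ^ 5) ^ 2 - φ(X ^ 25) ^ 2`. -/
theorem residuePart_five_zero_thetaSeries_sq :
    residuePart 5 0 (thetaSeries R ^ 2) =
      2 * expand 5 (by norm_num) (thetaSeries R) ^ 2 -
        expand 5 (by norm_num) (expand 5 (by norm_num) (thetaSeries R)) ^ 2 := by
  simp only [← map_pow]
  ext n
  rw [coeff_residuePart, show (2 : R⟦X⟧) = C (2 : R) from rfl, map_sub, coeff_C_mul,
    coeff_expand, coeff_expand]
  simp only [ZMod.natCast_eq_zero_iff]
  split_ifs with h
  · obtain ⟨m, rfl⟩ := h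
    rw [Nat.mul_div_cancel_left _ (by norm_num), coeff_expand]
    simp only [coeff_thetaSeries_sq_eq_card]
    have h := congrArg (Nat.cast (R := R)) (card_circlePoints_five_mul m)
    push_cast at h
    rw [← h]
    ring
  · ring

/-- The squares modulo `5` are `0`, `1` and `4`. -/
theorem thetaSeries_eq_sum_residuePart :
    thetaSeries R = residuePart 5 0 (thetaSeries R) + residuePart 5 1 (thetaSeries R) +
      residuePart 5 4 (thetaSeries R) := by
  ext n
  rw [map_add, map_add, coeff_residuePart, coeff_residuePart, coeff_residuePart]
  by_cases h : coeff n (thetaSeries R) = 0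
  · simp [h]
  obtain ⟨t, rfl⟩ := isSquare_of_coeff_thetaSeries_ne_zero h
  push_cast
  generalize coeff (t * t) (thetaSeries R) = r
  have key : ∀ s : ZMod 5, (s * s = 0 ∧ s * s ≠ 1 ∧ s * s ≠ 4) ∨
    (s * s ≠ 0 ∧ s * s = 1 ∧ s * s ≠ 4) ∨ (s * s ≠ 0 ∧ s * s ≠ 1 ∧ s * s = 4) := by decide
  rcases key t with ⟨h0, h1, h4⟩ | ⟨h0, h1, h4⟩ | ⟨h0, h1, h4⟩
  · rw [if_pos h0, if_neg h1, if_neg h4, add_zero, add_zero]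
  · rw [if_neg h0, if_pos h1, if_neg h4, add_zero, zero_add]
  · rw [if_neg h0, if_neg h1, if_pos h4, add_zero, zero_add]

end

/-- Modulo `5`, the part of `φ ^ 4` with exponents divisible by `5` is `φ(X ^ 5) ^ 4`; in other
words, the numbers of representations of `5 * n` and of `n` as a sum of four squares agree
modulo `5`. -/
theorem residuePart_five_zero_thetaSeries_pow_four :
    residuePart 5 0 (thetaSeries (ZMod 5) ^ 4) =
      expand 5 (by norm_num) (thetaSeries (ZMod 5)) ^ 4 := by
  have hsum := thetaSeries_eq_sum_residuePart (R := ZMod 5)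
  have hsq := residuePart_five_zero_thetaSeries_sq (R := ZMod 5)
  rw [← residuePart_zero_thetaSeries Nat.prime_five] at hsq
  have ha := supportedMod_residuePart 5 0 (thetaSeries (ZMod 5))
  have hb := supportedMod_residuePart 5 1 (thetaSeries (ZMod 5))
  have hc := supportedMod_residuePart 5 4 (thetaSeries (ZMod 5))
  set a := residuePart 5 0 (thetaSeries (ZMod 5))
  set b := residuePart 5 1 (thetaSeries (ZMod 5))
  set c := residuePart 5 4 (thetaSeries (ZMod 5))
  set Y := expand 5 (by norm_num) (thetaSeries (ZMod 5))
  have hmon (i j k : ℕ) : SupportedMod 5 (j + 4 * k) (a ^ i * b ^ j * c ^ k) := by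
    convert ((ha.pow i).mul (hb.pow j)).mul (hc.pow k) using 1
    ring
  have hzero (i j k : ℕ) (h : (j + 4 * k : ZMod 5) ≠ 0) :
      residuePart 5 0 (a ^ i * b ^ j * c ^ k) = 0 := (hmon i j k).residuePart_eq_zero h
  have hself (i j k : ℕ) (h : (j + 4 * k : ZMod 5) = 0) :
      residuePart 5 0 (a ^ i * b ^ j * c ^ k) = a ^ i * b ^ j * c ^ k :=
    SupportedMod.residuePart_eq (h ▸ hmon i j k)
  have h5 : (5 : (ZMod 5)⟦X⟧) = 0 := by
    rw [show (5 : (ZMod 5)⟦X⟧) = C (5 : ZMod 5) from rfl, show (5 : ZMod 5) = 0 from rfl, map_zero]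
  have e2 : thetaSeries (ZMod 5) ^ 2 = a ^ 2 * b ^ 0 * c ^ 0
      + (2 : ZMod 5) • (a ^ 0 * b ^ 1 * c ^ 1)
      + (2 : ZMod 5) • (a ^ 1 * b ^ 1 * c ^ 0) + (2 : ZMod 5) • (a ^ 1 * b ^ 0 * c ^ 1)
      + a ^ 0 * b ^ 2 * c ^ 0 + a ^ 0 * b ^ 0 * c ^ 2 := by
    rw [hsum]
    simp only [smul_eq_C_mul, map_ofNat]
    ring
  have e4 : thetaSeries (ZMod 5) ^ 4 = a ^ 4 * b ^ 0 * c ^ 0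
      + (12 : ZMod 5) • (a ^ 2 * b ^ 1 * c ^ 1) + (6 : ZMod 5) • (a ^ 0 * b ^ 2 * c ^ 2)
      + (4 : ZMod 5) • (a ^ 3 * b ^ 1 * c ^ 0) + (4 : ZMod 5) • (a ^ 3 * b ^ 0 * c ^ 1)
      + (6 : ZMod 5) • (a ^ 2 * b ^ 2 * c ^ 0) + (6 : ZMod 5) • (a ^ 2 * b ^ 0 * c ^ 2)
      + (4 : ZMod 5) • (a ^ 1 * b ^ 3 * c ^ 0) + (4 : ZMod 5) • (a ^ 1 * b ^ 0 * c ^ 3)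
      + (12 : ZMod 5) • (a ^ 1 * b ^ 2 * c ^ 1) + (12 : ZMod 5) • (a ^ 1 * b ^ 1 * c ^ 2)
      + a ^ 0 * b ^ 4 * c ^ 0 + a ^ 0 * b ^ 0 * c ^ 4
      + (4 : ZMod 5) • (a ^ 0 * b ^ 3 * c ^ 1) + (4 : ZMod 5) • (a ^ 0 * b ^ 1 * c ^ 3) := by
    rw [hsum]
    simp only [smul_eq_C_mul, map_ofNat]
    ring
  have z2 : residuePart 5 0 (thetaSeries (ZMod 5) ^ 2) = a ^ 2 + 2 * (b * c) := by
    rw [e2]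
    simp only [map_add, map_smul]
    rw [hself 2 0 0 (by decide), hself 0 1 1 (by decide), hzero 1 1 0 (by decide),
      hzero 1 0 1 (by decide), hzero 0 2 0 (by decide), hzero 0 0 2 (by decide)]
    simp only [smul_eq_C_mul, map_ofNat]
    ring
  have z4 : residuePart 5 0 (thetaSeries (ZMod 5) ^ 4) =
      a ^ 4 + 12 * a ^ 2 * (b * c) + 6 * (b * c) ^ 2 := by
    rw [e4]
    simp only [map_add, map_smul]
    rw [hself 4 0 0 (by decide), hself 2 1 1 (by decide), hself 0 2 2 (by decide),
      hzero 3 1 0 (by decide), hzero 3 0 1 (by decide), hzero 2 2 0 (by decide),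
      hzero 2 0 2 (by decide), hzero 1 3 0 (by decide), hzero 1 0 3 (by decide),
      hzero 1 2 1 (by decide), hzero 1 1 2 (by decide), hzero 0 4 0 (by decide),
      hzero 0 0 4 (by decide), hzero 0 3 1 (by decide), hzero 0 1 3 (by decide)]
    simp only [smul_eq_C_mul, map_ofNat]
    ring
  -- `z2` and `hsq` give `2 * (b * c) = 2 * (Y ^ 2 - a ^ 2)`; `3` is inverse to `2`
  have hbc : b * c = Y ^ 2 - a ^ 2 := by
    linear_combination 3 * (hsq - z2) - (b * c - Y ^ 2 + a ^ 2) * h5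
  rw [z4, hbc]
  linear_combination (Y ^ 4 - a ^ 4) * h5

theorem thetaSeries_zmod_pow (p : ℕ) [Fact p.Prime] :
    thetaSeries (ZMod p) ^ p = expand p (NeZero.ne p) (thetaSeries (ZMod p)) := by
  have h : PowerSeries.map (frobenius (ZMod p) p) (expand p (NeZero.ne p) (thetaSeries (ZMod p))) =
      thetaSeries (ZMod p) ^ p := MvPowerSeries.map_frobenius_expand p (NeZero.ne p)
  rw [← h, ZMod.frobenius_zmod]
  rfl

/-! ### Divisibility by five -/

theorem five_dvd_overpartitionCount_five_mul {m : ℕ}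
    (h : ∀ x y z : ℕ, x ^ 2 + y ^ 2 + z ^ 2 ≠ m) : 5 ∣ overpartitionCount (5 * m) := by
  rw [← coeff_map_rescale_overpartitionSeries_eq_zero_iff]
  have hP := rescale_overpartitionSeries_mul_thetaSeries (ZMod 5)
  set P := PowerSeries.map (Int.castRingHom (ZMod 5)) (rescale (-1) overpartitionSeries)
  set T := thetaSeries (ZMod 5) with hT
  have h5 : T ^ 5 = expand 5 (by norm_num) T := @thetaSeries_zmod_pow 5 ⟨Nat.prime_five⟩
  have hPT : P * expand 5 (by norm_num) T = T ^ 4 := by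
    rw [← h5]
    linear_combination T ^ 4 * hP
  have hZ := congrArg (residuePart 5 0) hPT
  rw [residuePart_mul_of_supportedMod_zero _ _ (supportedMod_expand _ _),
    residuePart_five_zero_thetaSeries_pow_four, ← hT] at hZ
  have hinv : expand 5 (by norm_num) P * expand 5 (by norm_num) T = 1 := by
    rw [← map_mul, hP, map_one]
  have hZP : residuePart 5 0 P = expand 5 (by norm_num) (T ^ 3) := by
    rw [map_pow]
    linear_combination expand 5 (by norm_num) P * hZ +
      (expand 5 (by norm_num) T ^ 3 - residuePart 5 0 P) * hinv
  have hcoeff := congrArg (coeff (5 * m)) hZP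
  rw [coeff_residuePart, if_pos (by rw [ZMod.natCast_eq_zero_iff]; exact dvd_mul_right 5 m),
    coeff_expand_mul] at hcoeff
  rw [hcoeff]
  by_contra hne
  obtain ⟨x, y, z, hxyz⟩ := exists_sum_three_sq_of_coeff_thetaSeries_cube_ne_zero hne
  exact h x y z hxyz

theorem mainTheorem4 (n k : ℕ) :
    overpartitionCount (4 ^ k * (40 * n + 35)) ≡ 0 [MOD 40] := by
  rw [Nat.modEq_zero_iff_dvd, show 40 = 8 * 5 from rfl]
  refine Nat.Coprime.mul_dvd_of_dvd_of_dvd (by norm_num) ?_ ?_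
  · rw [show 8 * 5 * n + 35 = 8 * (5 * n + 4) + 3 by ring]
    exact eight_dvd_overpartitionCount fun x y ↦ sum_two_sq_ne_four_pow_mul _ k x y
  · rw [show 4 ^ k * (8 * 5 * n + 35) = 5 * (4 ^ k * (8 * n + 7)) by ring]
    exact five_dvd_overpartitionCount_five_mul fun x y z ↦ sum_three_sq_ne_four_pow_mul n k x y z
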